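/- Let $N\ge 3$, and let $V:(0,\infty)\to[0,\infty)$ and $K:(0,\infty)\to(0,\infty)$ be continuous, with a constant $C_V>0$ such that $V(r)\le C_V/r^2$ for all $r\in(0,1)$. Let $f:\mathbb R\to\mathbb R$ be the unique solution of $f'(t)=1/\sqrt{1+2f(t)^2}$ on $\mathbb R$, $f(0)=0$. Let $D_r^{1,2}(\mathbb R^N)$ be the closure of the radial functions in $C_c^\infty(\mathbb R^N)$ with respect to the norm $\|u\|_{1,2}=\left(\int_{\mathbb R^N}|\nabla u|^2\,dx\right)^{1/2}$ (realized as a space of functions in $L^{2N/(N-2)}(\mathbb R^N)$ through the Sobolev inequality), let $$E=\Big\{u\in D_r^{1,2}(\mathbb R^N):\int_{\mathbb R^N}V(|x|)f(u)^2\,dx<\infty\Big\},$$ $$\|u\|=\|u\|_{1,2}+\inf_{k>0}\frac1k\Big[1+\int_{\mathbb R^N}V(|x|)f(ku)^2\,dx\Big],$$ and, for $q>1$, $R>0$ and $B_R=\{x\in\mathbb R^N:|x|<R\}$, let $$\mathcal S_0(q,R)=\sup_{u\in E,\ \|u\|=1}\int_{B_R}K(|x|)|u|^q\,dx\in[0,\infty].$$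 For $\alpha\in\mathbb R$ and $\beta\in[0,1]$ put $$\alpha^*(\beta)=\max\Big\{\beta\tfrac{N+2}{2}-1-\tfrac N2,\ \tfrac\beta2(3N-2)-N\Big\},\qquad q_0^*(\alpha,\beta)=\frac{2\alpha+2N-\beta(N+2)}{N-2}.$$ **Theorem.** Assume that for some $R_1>0$, $0\le\beta_0\le1$ and $\alpha_0>\alpha^*(\beta_0)$, $$\sup_{r\in(0,R_1)}\frac{K(r)}{r^{\alpha_0}V(r)^{\beta_0}}<+\infty,$$ where $V(r)^0=1$ even if $V(r)=0$, and the quotient is $+\infty$ if its denominator vanishes. Then, for every $q_1\in\mathbb R$ with $\max\{1,2\beta_0\}<q_1<q_0^*(\alpha_0,\beta_0)$, $$\lim_{R\to0^+}\mathcal S_0(q_1,R)=0.$$ In fact there are $\delta>0$ and $C>0$, independent of $R$, such that $\mathcal S_0(q_1,R)\le C R^\delta$ for all $R\in(0,R_1)$. -/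

import Mathlib

open MeasureTheory Set Filter Topology
open scoped ENNReal

noncomputable section

namespace QuasilinearSchrodinger

/-- `h` solves the Cauchy problem `h' = 1 / √(1 + 2 h²)` on `ℝ`, `h 0 = 0`. -/
def SolvesCauchyProblem (h : ℝ → ℝ) : Prop :=
  h 0 = 0 ∧ ∀ t, HasDerivAt h (1 / √(1 + 2 * h t ^ 2)) t

/-- A primitive of `√(1 + 2 s²)`; its inverse solves the Cauchy problem. -/
def cauchyPrimitive (s : ℝ) : ℝ := ∫ τ in (0 : ℝ)..s, √(1 + 2 * τ ^ 2)

theorem hasDerivAt_cauchyPrimitive (s : ℝ) :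
    HasDerivAt cauchyPrimitive (√(1 + 2 * s ^ 2)) s := by
  have hc : Continuous fun τ : ℝ => √(1 + 2 * τ ^ 2) := by fun_prop
  exact intervalIntegral.integral_hasDerivAt_right (hc.intervalIntegrable _ _)
    (hc.stronglyMeasurableAtFilter _ _) hc.continuousAt

theorem one_le_sqrt_aux (s : ℝ) : 1 ≤ √(1 + 2 * s ^ 2) := by
  rw [Real.one_le_sqrt]
  nlinarith [sq_nonneg s]

theorem monotone_cauchyPrimitive_sub : Monotone fun s => cauchyPrimitive s - s := by
  have hd : ∀ s, HasDerivAt (fun s => cauchyPrimitive s - s) (√(1 + 2 * s ^ 2) - 1) s :=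
    fun s => (hasDerivAt_cauchyPrimitive s).sub (hasDerivAt_id s)
  refine monotone_of_deriv_nonneg (fun s => (hd s).differentiableAt) fun s => ?_
  rw [(hd s).deriv]
  linarith [one_le_sqrt_aux s]

theorem cauchyPrimitive_zero : cauchyPrimitive 0 = 0 := by simp [cauchyPrimitive]

theorem strictMono_cauchyPrimitive : StrictMono cauchyPrimitive := fun a b hab => by
  have := monotone_cauchyPrimitive_sub hab.le
  simp only at this
  linarith

theorem continuous_cauchyPrimitive : Continuous cauchyPrimitive :=
  continuous_iff_continuousAt.2 fun s => (hasDerivAt_cauchyPrimitive s).continuousAt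

theorem surjective_cauchyPrimitive : Function.Surjective cauchyPrimitive := by
  refine continuous_cauchyPrimitive.surjective ?_ ?_
  · refine tendsto_atTop_mono' _ ?_ tendsto_id
    filter_upwards [eventually_ge_atTop (0 : ℝ)] with s hs
    have := monotone_cauchyPrimitive_sub hs
    simp only [cauchyPrimitive_zero] at this
    simp only [id]
    linarith
  · refine tendsto_atBot_mono' _ ?_ tendsto_id
    filter_upwards [eventually_le_atBot (0 : ℝ)] with s hs
    have := monotone_cauchyPrimitive_sub hs
    simp only [cauchyPrimitive_zero] at this
    simp only [id]
    linarith

/-- The Cauchy problem has exactly one solution. -/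
theorem existsUnique_solvesCauchyProblem : ∃! h : ℝ → ℝ, SolvesCauchyProblem h := by
  let e : ℝ ≃o ℝ :=
    strictMono_cauchyPrimitive.orderIsoOfSurjective _ surjective_cauchyPrimitive
  have he : ∀ s, e s = cauchyPrimitive s := fun s => rfl
  refine ⟨e.symm, ⟨?_, fun t => ?_⟩, ?_⟩
  · rw [e.symm_apply_eq, he, cauchyPrimitive_zero]
  · have hpos : √(1 + 2 * (e.symm t) ^ 2) ≠ 0 := by
      have := one_le_sqrt_aux (e.symm t)
      positivity
    have := HasDerivAt.of_local_left_inverse (f := cauchyPrimitive) (g := e.symm) (a := t)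
      e.symm.continuous.continuousAt (hasDerivAt_cauchyPrimitive _) hpos
      (Eventually.of_forall fun y => by rw [← he, e.apply_symm_apply])
    rwa [one_div]
  · rintro h ⟨h0, hd⟩
    have hcomp : ∀ t, HasDerivAt (fun t => cauchyPrimitive (h t) - t) 0 t := fun t => by
      have h1 := ((hasDerivAt_cauchyPrimitive (h t)).comp t (hd t)).sub (hasDerivAt_id t)
      have h2 : √(1 + 2 * h t ^ 2) ≠ 0 := by
        have := one_le_sqrt_aux (h t)
        positivity
      rw [mul_one_div_cancel h2, sub_self] at h1
      exact h1
    funext t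
    have hconst := is_const_of_deriv_eq_zero (fun t => (hcomp t).differentiableAt)
      (fun t => (hcomp t).deriv) t 0
    simp only [h0, cauchyPrimitive_zero, sub_zero] at hconst
    rw [eq_comm, e.symm_apply_eq, he]
    linarith

/-- The change of variable `f`: the unique solution of `f' = 1 / √(1 + 2 f²)`, `f 0 = 0`. -/
def f : ℝ → ℝ := Classical.choose existsUnique_solvesCauchyProblem.exists

theorem f_spec : SolvesCauchyProblem f :=
  Classical.choose_spec existsUnique_solvesCauchyProblem.exists

/-- The hypothesis `(H)` on the potentials. Functions on `ℝ₊ = (0, ∞)` are represented by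
functions on `ℝ` of which only the values on `(0, ∞)` matter. -/
structure HypH (V K : ℝ → ℝ) : Prop where
  V_cont : ContinuousOn V (Ioi 0)
  K_cont : ContinuousOn K (Ioi 0)
  V_nonneg : ∀ r, 0 < r → 0 ≤ V r
  K_pos : ∀ r, 0 < r → 0 < K r
  V_le : ∃ C : ℝ, 0 < C ∧ ∀ r ∈ Ioo (0 : ℝ) 1, V r ≤ C / r ^ 2

/-- `G` is a weak (distributional) gradient of `u` on `ℝ^N`. -/
def HasWeakGradient {N : ℕ} (u : EuclideanSpace ℝ (Fin N) → ℝ)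
    (G : EuclideanSpace ℝ (Fin N) → EuclideanSpace ℝ (Fin N)) : Prop :=
  LocallyIntegrable u ∧ LocallyIntegrable G ∧
    ∀ φ : EuclideanSpace ℝ (Fin N) → ℝ, ContDiff ℝ (⊤ : ℕ∞) φ → HasCompactSupport φ →
      ∀ v : EuclideanSpace ℝ (Fin N),
        ∫ x, u x * fderiv ℝ φ x v = - ∫ x, inner ℝ (G x) v * φ x

open Classical in
/-- The weak gradient of `u` (unique up to null sets), and `0` if there is none. -/
def weakGradient {N : ℕ} (u : EuclideanSpace ℝ (Fin N) → ℝ) :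
    EuclideanSpace ℝ (Fin N) → EuclideanSpace ℝ (Fin N) :=
  if h : ∃ G, HasWeakGradient u G then h.choose else 0

/-- The class `C_{c,r}^∞(ℝ^N)` of radial smooth functions with compact support. -/
def IsRadialTest {N : ℕ} (φ : EuclideanSpace ℝ (Fin N) → ℝ) : Prop :=
  ContDiff ℝ (⊤ : ℕ∞) φ ∧ HasCompactSupport φ ∧ ∀ x y, ‖x‖ = ‖y‖ → φ x = φ y

/-- The critical Sobolev exponent `2* = 2N / (N - 2)`. -/
def twoStar (N : ℕ) : ℝ≥0∞ := ENNReal.ofReal (2 * N / (N - 2))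

/-- `u ∈ D_r^{1,2}(ℝ^N)`, the closure of `C_{c,r}^∞(ℝ^N)` in the norm `‖∇u‖_{L²}`.
By the Sobolev inequality a sequence of test functions that is Cauchy in this norm converges in
`L^{2*}`, and the elements of the completion are the functions arising as these limits. -/
def MemD12r {N : ℕ} (u : EuclideanSpace ℝ (Fin N) → ℝ) : Prop :=
  MemLp u (twoStar N) ∧
  (∃ G, HasWeakGradient u G) ∧
  MemLp (weakGradient u) 2 ∧
  ∃ φ : ℕ → EuclideanSpace ℝ (Fin N) → ℝ, (∀ n, IsRadialTest (φ n)) ∧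
    Tendsto (fun n => eLpNorm (fun x => gradient (φ n) x - weakGradient u x) 2 volume)
      atTop (𝓝 0) ∧
    Tendsto (fun n => eLpNorm (fun x => φ n x - u x) (twoStar N) volume) atTop (𝓝 0)

/-- The modular `∫ V(|x|) f(u)² dx`, with values in `[0, ∞]`. -/
def modular {N : ℕ} (V : ℝ → ℝ) (u : EuclideanSpace ℝ (Fin N) → ℝ) : ℝ≥0∞ :=
  ∫⁻ x, ENNReal.ofReal (V ‖x‖ * f (u x) ^ 2)

/-- `u ∈ E`. -/
def MemE {N : ℕ} (V : ℝ → ℝ) (u : EuclideanSpace ℝ (Fin N) → ℝ) : Prop :=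
  MemD12r u ∧ modular V u < ∞

/-- The Orlicz norm `‖u‖_o = inf_{k > 0} (1/k) (1 + ∫ V(|x|) f(k u)² dx)`. -/
def orliczNorm {N : ℕ} (V : ℝ → ℝ) (u : EuclideanSpace ℝ (Fin N) → ℝ) : ℝ≥0∞ :=
  ⨅ (k : ℝ) (_ : 0 < k), ENNReal.ofReal (1 / k) * (1 + modular V fun x => k * u x)

/-- The norm `‖u‖ = ‖u‖_{1,2} + ‖u‖_o` of `E`. -/
def normE {N : ℕ} (V : ℝ → ℝ) (u : EuclideanSpace ℝ (Fin N) → ℝ) : ℝ≥0∞ :=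
  eLpNorm (weakGradient u) 2 volume + orliczNorm V u

/-- `S_0(q, R)`, the supremum of `∫_{B_R} K(|x|) |u|^q dx` over `u ∈ E` with `‖u‖ = 1`; it may
be infinite. -/
def S0 (N : ℕ) (V K : ℝ → ℝ) (q R : ℝ) : ℝ≥0∞ :=
  ⨆ (u : EuclideanSpace ℝ (Fin N) → ℝ) (_ : MemE V u) (_ : normE V u = 1),
    ∫⁻ x in Metric.ball 0 R, ENNReal.ofReal (K ‖x‖ * |u x| ^ q)

/-- `α*(β)`. -/
def alphaStar (N : ℕ) (β : ℝ) : ℝ :=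
  max (β * ((N + 2) / 2) - 1 - N / 2) (β / 2 * (3 * N - 2) - N)

/-- `q_0*(α, β)`. -/
def q0Star (N : ℕ) (α β : ℝ) : ℝ := (2 * α + 2 * N - β * (N + 2)) / (N - 2)

end QuasilinearSchrodinger

end

/-! Three facts give the estimate. Near the origin `K r ≤ Λ r^α V^β`. A unit vector of `E` satisfies
`∫ V min(u², |u|) ≤ 12`, because `f(t)²` dominates `min(t², |t|) / 3` (`min_sq_abs_le`,
`lintegral_min_le_of_orliczNorm_le_one`). By radial symmetry and Cauchy–Schwarz, `|u x| ≤ C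
|x|^(-(N-2)/2)` almost everywhere (`exists_ae_enorm_le_of_memD12r`).

The power `|u|^q` is then split as `min(u², |u|)^β` times a factor bounded by `1 + (C
|x|^(-(N-2)/2))^(q-β)` (`rpow_le_min_rpow_mul`). Hölder with exponents `1/β` and `1/(1-β)` leaves
only integrals of powers of `|x|` over `B_R` (`lintegral_ball_rpow_mul_norm_rpow_le`). The worse of
the two resulting powers of `R` is `δ = α - (N-2)/2 (q-β) + N (1-β)`, and `δ > 0` says exactly `q <
q_0*(α, β)`. -/

noncomputable section

namespace QuasilinearSchrodinger

/-! ### Polar coordinates and integrals of powers. -/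

section Polar

variable {E : Type*} [NormedAddCommGroup E] [NormedSpace ℝ E] [MeasurableSpace E] [BorelSpace E]
  [FiniteDimensional ℝ E] [Nontrivial E] (μ : Measure E) [μ.IsAddHaarMeasure]

/-- Polar coordinates for the Lebesgue integral of a radial function. -/
theorem lintegral_fun_norm_addHaar {F : ℝ → ℝ≥0∞} (hF : Measurable F) :
    ∫⁻ x, F ‖x‖ ∂μ = (Module.finrank ℝ E * μ (Metric.ball 0 1)) *
      ∫⁻ y in Ioi (0 : ℝ), ENNReal.ofReal (y ^ (Module.finrank ℝ E - 1)) * F y := by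
  have hm : Measurable fun y : Ioi (0 : ℝ) => F y := hF.comp measurable_subtype_coe
  calc
    ∫⁻ x, F ‖x‖ ∂μ = ∫⁻ x : ({(0)}ᶜ : Set E), F ‖x.1‖ ∂(μ.comap (↑)) := by
      rw [lintegral_subtype_comap (measurableSet_singleton _).compl fun x ↦ F ‖x‖,
        restrict_compl_singleton]
    _ = ∫⁻ x, F x.2 ∂μ.toSphere.prod (.volumeIoiPow (Module.finrank ℝ E - 1)) := by
      simpa using μ.measurePreserving_homeomorphUnitSphereProd.lintegral_comp_emb
        (Homeomorph.measurableEmbedding _) (F ∘ Subtype.val ∘ Prod.snd)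
    _ = μ.toSphere univ *
        ∫⁻ x : Ioi (0 : ℝ), F x ∂.volumeIoiPow (Module.finrank ℝ E - 1) := by
      rw [lintegral_prod (fun x : Metric.sphere (0 : E) 1 × Ioi (0 : ℝ) => F x.2)
        (hm.comp measurable_snd).aemeasurable]
      simp only [lintegral_const]
      rw [mul_comm]
    _ = _ := by
      rw [μ.toSphere_apply_univ, Measure.volumeIoiPow,
        lintegral_withDensity_eq_lintegral_mul _ (by fun_prop) hm]
      congr 1
      exact lintegral_subtype_comap measurableSet_Ioi
        fun y : ℝ => ENNReal.ofReal (y ^ (Module.finrank ℝ E - 1)) * F y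

end Polar

theorem lintegral_Ioo_rpow {a R : ℝ} (ha : -1 < a) (hR : 0 < R) :
    ∫⁻ y in Ioo 0 R, ENNReal.ofReal (y ^ a) = ENNReal.ofReal (R ^ (a + 1) / (a + 1)) := by
  rw [Measure.restrict_congr_set Ioo_ae_eq_Ioc, ← ofReal_integral_eq_lintegral_ofReal,
    ← intervalIntegral.integral_of_le hR.le, integral_rpow (Or.inl ha),
    Real.zero_rpow (by linarith), sub_zero]
  · exact (intervalIntegral.intervalIntegrable_rpow' ha).1
  · filter_upwards [ae_restrict_mem measurableSet_Ioc] with y hy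
    exact Real.rpow_nonneg hy.1.le _

theorem lintegral_Ioi_rpow {a r : ℝ} (ha : a < -1) (hr : 0 < r) :
    ∫⁻ y in Ioi r, ENNReal.ofReal (y ^ a) = ENNReal.ofReal (-r ^ (a + 1) / (a + 1)) := by
  rw [← ofReal_integral_eq_lintegral_ofReal, integral_Ioi_rpow_of_lt ha hr]
  · exact integrableOn_Ioi_rpow_of_lt ha hr
  · filter_upwards [ae_restrict_mem measurableSet_Ioi] with y hy
    exact Real.rpow_nonneg (hr.trans hy).le _

/-! ### Power weights on small balls. -/

section Ball

variable {N : ℕ}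

theorem lintegral_ball_norm_rpow (hN : 0 < N) {γ : ℝ} (hγ : 0 < γ + N) :
    ∃ C : ℝ, 0 < C ∧ ∀ R : ℝ, 0 < R →
      ∫⁻ x : EuclideanSpace ℝ (Fin N) in Metric.ball 0 R, ENNReal.ofReal (‖x‖ ^ γ) ≤
        ENNReal.ofReal (C * R ^ (γ + N)) := by
  have : NeZero N := ⟨hN.ne'⟩
  have hN1 : ((N - 1 : ℕ) : ℝ) = N - 1 := by rw [Nat.cast_sub hN]; simp
  set b : ℝ := (volume (Metric.ball (0 : EuclideanSpace ℝ (Fin N)) 1)).toReal with hb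
  have hb0 : 0 < b := ENNReal.toReal_pos
    (Metric.measure_ball_pos _ _ one_pos).ne' measure_ball_lt_top.ne
  have hbe : volume (Metric.ball (0 : EuclideanSpace ℝ (Fin N)) 1) = ENNReal.ofReal b :=
    (ENNReal.ofReal_toReal measure_ball_lt_top.ne).symm
  have hN' : (0 : ℝ) < N := by exact_mod_cast hN
  refine ⟨N * b / (γ + N), by positivity, fun R hR => le_of_eq ?_⟩
  -- Cutting off at radius `R` keeps the integrand radial, so the polar formula on the whole space
  -- applies.
  have hF : Measurable ((Iio R).indicator fun y : ℝ => ENNReal.ofReal (y ^ γ)) :=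
    (by fun_prop : Measurable fun y : ℝ => ENNReal.ofReal (y ^ γ)).indicator measurableSet_Iio
  have h1 := lintegral_fun_norm_addHaar (volume : Measure (EuclideanSpace ℝ (Fin N))) hF
  rw [← lintegral_indicator measurableSet_ball]
  have h2 : (Metric.ball (0 : EuclideanSpace ℝ (Fin N)) R).indicator
      (fun x => ENNReal.ofReal (‖x‖ ^ γ)) =
      fun x => (Iio R).indicator (fun y : ℝ => ENNReal.ofReal (y ^ γ)) ‖x‖ := by
    ext x; simp [indicator]
  rw [h2, h1, finrank_euclideanSpace_fin, hbe]
  have h3 : ∫⁻ y in Ioi (0 : ℝ), ENNReal.ofReal (y ^ (N - 1)) *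
      (Iio R).indicator (fun y : ℝ => ENNReal.ofReal (y ^ γ)) y =
      ∫⁻ y in Ioo (0 : ℝ) R, ENNReal.ofReal (y ^ (γ + N - 1)) := by
    rw [← lintegral_indicator measurableSet_Ioi, ← lintegral_indicator measurableSet_Ioo]
    congr 1
    ext y
    by_cases hy : 0 < y <;> by_cases hyR : y < R <;> simp [indicator, hy, hyR]
    rw [← ENNReal.ofReal_mul (by positivity), ← Real.rpow_natCast, ← Real.rpow_add hy, hN1]
    ring_nf
  rw [h3, lintegral_Ioo_rpow (by linarith) hR, ← ENNReal.ofReal_natCast,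
    ← ENNReal.ofReal_mul (by positivity), ← ENNReal.ofReal_mul (by positivity)]
  congr 1
  rw [sub_add_cancel]
  ring

/-- Hölder's inequality against a power weight on a small ball. -/
theorem lintegral_ball_rpow_mul_norm_rpow_le (hN : 0 < N) {β γ M : ℝ} (hβ0 : 0 ≤ β) (hβ1 : β ≤ 1)
    (hγ : 0 < γ + N * (1 - β)) (hM : 0 < M) :
    ∃ C : ℝ, 0 < C ∧ ∀ W : EuclideanSpace ℝ (Fin N) → ℝ≥0∞, AEMeasurable W →
      ∫⁻ x, W x ≤ ENNReal.ofReal M → ∀ R : ℝ, 0 < R →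
      ∫⁻ x in Metric.ball 0 R, W x ^ β * ENNReal.ofReal (‖x‖ ^ γ) ≤
        ENNReal.ofReal (C * R ^ (γ + N * (1 - β))) := by
  -- For `β = 1` the exponent `1/(1-β)` is infinite; then `γ > 0` and the weight is simply at most
  -- `R^γ`.
  rcases hβ1.eq_or_lt with rfl | hβ1
  · refine ⟨M, hM, fun W hW hWM R hR => ?_⟩
    have hγ0 : 0 < γ := by simpa using hγ
    calc ∫⁻ x in Metric.ball 0 R, W x ^ (1 : ℝ) * ENNReal.ofReal (‖x‖ ^ γ)
        ≤ ∫⁻ x in Metric.ball 0 R, W x * ENNReal.ofReal (R ^ γ) := by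
          refine setLIntegral_mono' measurableSet_ball fun x hx => ?_
          rw [ENNReal.rpow_one]
          have : ‖x‖ ≤ R := by simpa using (mem_ball_zero_iff.1 hx).le
          gcongr
      _ ≤ ∫⁻ x, W x * ENNReal.ofReal (R ^ γ) := setLIntegral_le_lintegral _ _
      _ = (∫⁻ x, W x) * ENNReal.ofReal (R ^ γ) := lintegral_mul_const' _ _ ENNReal.ofReal_ne_top
      _ ≤ ENNReal.ofReal M * ENNReal.ofReal (R ^ γ) := by gcongr
      _ = _ := by rw [← ENNReal.ofReal_mul hM.le]; simp
  · have h1β : 0 < 1 - β := by linarith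
    obtain ⟨C, hC, hCR⟩ := lintegral_ball_norm_rpow hN (γ := γ / (1 - β))
      (by rw [div_add' _ _ _ h1β.ne']; positivity)
    refine ⟨M ^ β * C ^ (1 - β), by positivity, fun W hW hWM R hR => ?_⟩
    calc ∫⁻ x in Metric.ball 0 R, W x ^ β * ENNReal.ofReal (‖x‖ ^ γ)
        = ∫⁻ x in Metric.ball 0 R, W x ^ β * ENNReal.ofReal (‖x‖ ^ (γ / (1 - β))) ^ (1 - β) := by
          refine lintegral_congr fun x => ?_
          rw [ENNReal.ofReal_rpow_of_nonneg (by positivity) h1β.le,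
            ← Real.rpow_mul (norm_nonneg _), div_mul_cancel₀ _ h1β.ne']
      _ ≤ (∫⁻ x in Metric.ball 0 R, W x) ^ β *
          (∫⁻ x : EuclideanSpace ℝ (Fin N) in Metric.ball 0 R,
            ENNReal.ofReal (‖x‖ ^ (γ / (1 - β)))) ^ (1 - β) :=
          ENNReal.lintegral_mul_norm_pow_le hW.restrict (by fun_prop) hβ0 h1β.le (by ring)
      _ ≤ ENNReal.ofReal M ^ β * ENNReal.ofReal (C * R ^ (γ / (1 - β) + N)) ^ (1 - β) := by
          gcongr
          · exact (setLIntegral_le_lintegral _ _).trans hWM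
          · exact hCR R hR
      _ = _ := by
          rw [ENNReal.ofReal_rpow_of_nonneg hM.le hβ0,
            ENNReal.ofReal_rpow_of_nonneg (by positivity) h1β.le,
            ← ENNReal.ofReal_mul (by positivity), Real.mul_rpow hC.le (by positivity),
            ← Real.rpow_mul hR.le, ← mul_assoc]
          congr 3
          field_simp

end Ball

/-! ### The change of variable -/

/-- The function `f √(1 + 2 f²) - t` vanishes at `0` and has derivative `2 f² / (1 + 2 f²) ≥ 0`, so
`|t| ≤ |f| √(1 + 2 f²)`. -/
theorem sq_le_f_sq (t : ℝ) : t ^ 2 ≤ f t ^ 2 * (1 + 2 * f t ^ 2) := by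
  obtain ⟨h0, hd⟩ := f_spec
  have hs : ∀ t, 0 < √(1 + 2 * f t ^ 2) := fun t => by positivity
  have hD : ∀ t, HasDerivAt (fun t => f t * √(1 + 2 * f t ^ 2) - t)
      (1 / √(1 + 2 * f t ^ 2) * √(1 + 2 * f t ^ 2) + f t *
        ((2 * (2 * f t * (1 / √(1 + 2 * f t ^ 2)))) / (2 * √(1 + 2 * f t ^ 2))) - 1) t := by
    intro t
    have h1 : HasDerivAt (fun t => 1 + 2 * f t ^ 2) (2 * (2 * f t * (1 / √(1 + 2 * f t ^ 2)))) t := by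
      simpa using (((hd t).pow 2).const_mul 2).const_add 1
    exact ((hd t).mul (h1.sqrt (by positivity))).sub (hasDerivAt_id t)
  have hmono : Monotone fun t => f t * √(1 + 2 * f t ^ 2) - t := by
    refine monotone_of_deriv_nonneg (fun t => (hD t).differentiableAt) fun t => ?_
    rw [(hD t).deriv, one_div_mul_cancel (hs t).ne']
    have : f t * ((2 * (2 * f t * (1 / √(1 + 2 * f t ^ 2)))) / (2 * √(1 + 2 * f t ^ 2))) =
      2 * f t ^ 2 * ((1 / √(1 + 2 * f t ^ 2)) * (1 / √(1 + 2 * f t ^ 2))) := by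
        have := hs t
        field_simp
    rw [this]
    have : 0 ≤ 2 * f t ^ 2 * ((1 / √(1 + 2 * f t ^ 2)) * (1 / √(1 + 2 * f t ^ 2))) := by positivity
    linarith
  have habs : |t| ≤ |f t * √(1 + 2 * f t ^ 2)| := by
    rcases le_total 0 t with ht | ht
    · have := hmono ht
      simp only [h0] at this
      rw [abs_of_nonneg ht]
      exact le_trans (by linarith) (le_abs_self _)
    · have := hmono ht
      simp only [h0] at this
      rw [abs_of_nonpos ht]
      exact le_trans (by linarith) (neg_le_abs _)
  have h2 := sq_le_sq.2 habs
  rwa [mul_pow, Real.sq_sqrt (by positivity)] at h2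

/-- If both `t²` and `|t|` exceeded `3 f²`, then `t² ≤ f² + 2 f⁴ < t²/3 + 2 t²/9`, which is absurd.
-/
theorem min_sq_abs_le (t : ℝ) : min (t ^ 2) |t| ≤ 3 * f t ^ 2 := by
  have h := sq_le_f_sq t
  by_contra! hlt
  obtain ⟨h1, h2⟩ := lt_min_iff.1 hlt
  have h3 : (f t ^ 2) ^ 2 ≤ t ^ 2 / 9 := by
    rw [← sq_abs t]
    nlinarith [sq_nonneg (f t)]
  nlinarith [sq_nonneg (f t)]

/-- Scaling by `k` multiplies the two entries of the minimum by `k²` and `k`, both at least `k/2`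
when `k ≥ 1/2`. The resulting factor `1/k` is the one in the Orlicz norm. -/
theorem min_sq_abs_le_mul {k t : ℝ} (hk : 1 / 2 ≤ k) :
    min (t ^ 2) |t| ≤ 6 * (1 / k) * f (k * t) ^ 2 := by
  have hk0 : 0 < k := by linarith
  have h1 : k / 2 * min (t ^ 2) |t| ≤ min ((k * t) ^ 2) |k * t| := by
    refine le_min ?_ ?_
    · rw [mul_pow]
      have := min_le_left (t ^ 2) |t|
      have h2 : k / 2 * min (t ^ 2) |t| ≤ k / 2 * t ^ 2 := by gcongr
      nlinarith [mul_nonneg hk0.le (sq_nonneg t)]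
    · rw [abs_mul, abs_of_pos hk0]
      have h2 : k / 2 * min (t ^ 2) |t| ≤ k / 2 * |t| := by
        gcongr
        exact min_le_right _ _
      nlinarith [mul_nonneg hk0.le (abs_nonneg t)]
  have h3 := h1.trans (min_sq_abs_le _)
  rw [show 6 * (1 / k) * f (k * t) ^ 2 = (3 * f (k * t) ^ 2) / (k / 2) by field_simp; ring,
    le_div_iff₀ (by positivity)]
  linarith

/-! ### Pointwise decay of radial functions. -/

/-- The splitting that inserts the polar weight, `m = N - 1`, before Cauchy–Schwarz. -/
theorem ofReal_rpow_mul_ofReal_rpow_half {y : ℝ} (hy : 0 < y) (m : ℝ) (a : ℝ≥0∞) :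
    (ENNReal.ofReal (y ^ m) * a ^ (2 : ℝ)) ^ (1 / 2 : ℝ) *
      ENNReal.ofReal (y ^ (-m)) ^ (1 / 2 : ℝ) = a := by
  rw [ENNReal.mul_rpow_of_nonneg _ _ (by norm_num), ← ENNReal.rpow_mul, mul_right_comm,
    ← ENNReal.mul_rpow_of_nonneg _ _ (by norm_num), ← ENNReal.ofReal_mul (by positivity),
    ← Real.rpow_add hy]
  simp

/-- The radial derivative of a radial test function is dominated by its gradient. -/
theorem IsRadialTest.enorm_deriv_le {N : ℕ} {φ : EuclideanSpace ℝ (Fin N) → ℝ}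
    (hφ : IsRadialTest φ) {e : EuclideanSpace ℝ (Fin N)} (he : ‖e‖ = 1)
    {y : EuclideanSpace ℝ (Fin N)} (hy : y ≠ 0) :
    ‖deriv (fun s : ℝ => φ (s • e)) ‖y‖‖ₑ ≤ ‖gradient φ y‖ₑ := by
  obtain ⟨hsm, -, hrad⟩ := hφ
  have hy0 : ‖y‖ ≠ 0 := norm_ne_zero_iff.2 hy
  set e' := ‖y‖⁻¹ • y with he'
  have hne' : ‖e'‖ = 1 := by rw [he', norm_smul, norm_inv, norm_norm, inv_mul_cancel₀ hy0]
  have hfun : (fun s : ℝ => φ (s • e)) = fun s : ℝ => φ (s • e') :=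
    funext fun s => hrad _ _ (by rw [norm_smul, norm_smul, he, hne'])
  have hye : ‖y‖ • e' = y := by rw [he', smul_smul, mul_inv_cancel₀ hy0, one_smul]
  have hdiff : HasFDerivAt φ (fderiv ℝ φ y) (‖y‖ • e') := by
    rw [hye]
    exact (hsm.differentiable (by simp) y).hasFDerivAt
  have hder : HasDerivAt (fun s : ℝ => φ (s • e')) (fderiv ℝ φ y e') ‖y‖ := by
    have := hdiff.comp_hasDerivAt ‖y‖ ((hasDerivAt_id ‖y‖).smul_const e')
    simpa [Function.comp_def] using this
  rw [hfun, hder.deriv, enorm_le_iff_norm_le]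
  calc ‖fderiv ℝ φ y e'‖ ≤ ‖fderiv ℝ φ y‖ * ‖e'‖ := ContinuousLinearMap.le_opNorm _ _
    _ = ‖gradient φ y‖ := by rw [hne', mul_one, gradient, LinearIsometryEquiv.norm_map]

/-- The radial lemma for test functions. -/
theorem exists_enorm_isRadialTest_le {N : ℕ} (hN : 3 ≤ N) :
    ∃ C : ℝ, 0 < C ∧ ∀ φ : EuclideanSpace ℝ (Fin N) → ℝ, IsRadialTest φ → ∀ x, x ≠ 0 →
      ‖φ x‖ₑ ≤ ENNReal.ofReal (C * ‖x‖ ^ (-((N - 2) / 2) : ℝ)) *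
        eLpNorm (gradient φ) 2 volume := by
  have : NeZero N := ⟨by omega⟩
  have hN3 : (3 : ℝ) ≤ N := by exact_mod_cast hN
  have hN1 : ((N - 1 : ℕ) : ℝ) = N - 1 := by rw [Nat.cast_sub (by omega)]; simp
  set κ : ℝ≥0∞ := N * volume (Metric.ball (0 : EuclideanSpace ℝ (Fin N)) 1) with hκ
  have hκ0 : κ ≠ 0 := mul_ne_zero (by simp [NeZero.ne N]) (Metric.measure_ball_pos _ _ one_pos).ne'
  have hκt : κ ≠ ∞ := ENNReal.mul_ne_top (by simp) measure_ball_lt_top.ne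
  have hc0 : 0 < κ.toReal := ENNReal.toReal_pos hκ0 hκt
  have hκe : κ⁻¹ = ENNReal.ofReal κ.toReal⁻¹ := by
    rw [ENNReal.ofReal_inv_of_pos hc0, ENNReal.ofReal_toReal hκt]
  refine ⟨(κ.toReal⁻¹) ^ (1 / 2 : ℝ) * (1 / (N - 2) : ℝ) ^ (1 / 2 : ℝ),
    mul_pos (by positivity) (Real.rpow_pos_of_pos (one_div_pos.2 (by linarith)) _),
    fun φ hφ x hx => ?_⟩
  -- Any unit vector would do: `φ` is radial, so its profile `g` is read off along one ray.
  set e : EuclideanSpace ℝ (Fin N) := EuclideanSpace.single 0 1 with hedef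
  have he : ‖e‖ = 1 := by simp [hedef]
  set g : ℝ → ℝ := fun s => φ (s • e) with hg
  have hgs : ContDiff ℝ 1 g := by
    have : ContDiff ℝ (⊤ : ℕ∞) g := hφ.1.comp (contDiff_id.smul contDiff_const)
    exact this.of_le (by exact_mod_cast le_top)
  have hgc : HasCompactSupport g :=
    hφ.2.1.comp_isClosedEmbedding (isClosedEmbedding_smul_left (norm_ne_zero_iff.1 (by simp [he])))
  have hg'c : Continuous (deriv g) := hgs.continuous_deriv le_rfl
  have hr : 0 < ‖x‖ := norm_pos_iff.2 hx
  have hgx : φ x = g ‖x‖ := hφ.2.2 _ _ (by simp [norm_smul, he])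
  have hA : κ * ∫⁻ y in Ioi (0 : ℝ), ENNReal.ofReal (y ^ (N - 1)) * ‖deriv g y‖ₑ ^ (2 : ℝ) ≤
      ∫⁻ y, ‖gradient φ y‖ₑ ^ (2 : ℝ) := by
    have := lintegral_fun_norm_addHaar (volume : Measure (EuclideanSpace ℝ (Fin N)))
      (F := fun y => ‖deriv g y‖ₑ ^ (2 : ℝ)) (by fun_prop)
    rw [finrank_euclideanSpace_fin] at this
    rw [← this]
    refine lintegral_mono_ae ?_
    have h0 : ∀ᵐ y : EuclideanSpace ℝ (Fin N), y ≠ 0 := by simp [ae_iff]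
    filter_upwards [h0] with y hy
    exact ENNReal.rpow_le_rpow (hφ.enorm_deriv_le he hy) (by norm_num)
  have hA' : ∫⁻ y in Ioi ‖x‖, ENNReal.ofReal (y ^ (N - 1 : ℝ)) * ‖deriv g y‖ₑ ^ (2 : ℝ) ≤
      κ⁻¹ * ∫⁻ y, ‖gradient φ y‖ₑ ^ (2 : ℝ) := by
    rw [← ENNReal.mul_le_iff_le_inv hκ0 hκt]
    refine le_trans ?_ hA
    gcongr κ * ?_
    refine (lintegral_mono_set (Ioi_subset_Ioi hr.le)).trans_eq ?_
    simp_rw [← hN1, Real.rpow_natCast]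
  -- Integrate the profile from `‖x‖` to infinity. Cauchy–Schwarz leaves the tail `∫ y^(-(N-1)) =
  -- ‖x‖^(-(N-2)) / (N-2)`, finite because `N ≥ 3`.
  calc ‖φ x‖ₑ = ‖∫ y in Ioi ‖x‖, deriv g y‖ₑ := by
        rw [hgc.integral_Ioi_deriv_eq hgs, enorm_neg, hgx]
    _ ≤ ∫⁻ y in Ioi ‖x‖, ‖deriv g y‖ₑ := enorm_integral_le_lintegral_enorm _
    _ = ∫⁻ y in Ioi ‖x‖,
          (ENNReal.ofReal (y ^ (N - 1 : ℝ)) * ‖deriv g y‖ₑ ^ (2 : ℝ)) ^ (1 / 2 : ℝ) *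
            ENNReal.ofReal (y ^ (-(N - 1) : ℝ)) ^ (1 / 2 : ℝ) :=
        setLIntegral_congr_fun measurableSet_Ioi fun y hy =>
          (ofReal_rpow_mul_ofReal_rpow_half (hr.trans hy) _ _).symm
    _ ≤ (∫⁻ y in Ioi ‖x‖, ENNReal.ofReal (y ^ (N - 1 : ℝ)) * ‖deriv g y‖ₑ ^ (2 : ℝ)) ^
          (1 / 2 : ℝ) * (∫⁻ y in Ioi ‖x‖, ENNReal.ofReal (y ^ (-(N - 1) : ℝ))) ^ (1 / 2 : ℝ) :=
        ENNReal.lintegral_mul_norm_pow_le (by fun_prop) (by fun_prop) (by norm_num) (by norm_num)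
          (by norm_num)
    _ ≤ (κ⁻¹ * ∫⁻ y, ‖gradient φ y‖ₑ ^ (2 : ℝ)) ^ (1 / 2 : ℝ) *
          ENNReal.ofReal (1 / (N - 2) * ‖x‖ ^ (-(N - 2) : ℝ)) ^ (1 / 2 : ℝ) := by
        gcongr
        rw [lintegral_Ioi_rpow (by linarith) hr]
        refine le_of_eq (congrArg _ ?_)
        rw [show (-(N - 1) + 1 : ℝ) = -(N - 2) by ring, neg_div_neg_eq, one_div_mul_eq_div]
    _ = _ := by
        have h2 : (0 : ℝ) ≤ 1 / (N - 2) := one_div_nonneg.2 (by linarith)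
        rw [eLpNorm_eq_lintegral_rpow_enorm_toReal (by norm_num) (by norm_num), hκe,
          ENNReal.toReal_ofNat, ENNReal.mul_rpow_of_nonneg _ _ (by norm_num), mul_right_comm]
        congr 1
        rw [ENNReal.ofReal_rpow_of_nonneg (by positivity) (by norm_num),
          ENNReal.ofReal_rpow_of_nonneg (by positivity) (by norm_num),
          ← ENNReal.ofReal_mul (by positivity), Real.mul_rpow h2 (by positivity),
          ← Real.rpow_mul (norm_nonneg _), ← mul_assoc]
        congr 3
        ring

/-- The radial lemma on `D_r^{1,2}`. -/
theorem exists_ae_enorm_le_of_memD12r {N : ℕ} (hN : 3 ≤ N) :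
    ∃ C : ℝ, 0 < C ∧ ∀ u : EuclideanSpace ℝ (Fin N) → ℝ, MemD12r u → ∀ᵐ x,
      ‖u x‖ₑ ≤ ENNReal.ofReal (C * ‖x‖ ^ (-((N - 2) / 2) : ℝ)) *
        eLpNorm (weakGradient u) 2 volume := by
  have : NeZero N := ⟨by omega⟩
  have hN3 : (3 : ℝ) ≤ N := by exact_mod_cast hN
  obtain ⟨C, hC, hCφ⟩ := exists_enorm_isRadialTest_le hN
  refine ⟨C, hC, ?_⟩
  rintro u ⟨hu, -, hG, φ, hφ, hφG, hφu⟩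
  have hp : twoStar N ≠ 0 := by
    rw [twoStar, Ne, ENNReal.ofReal_eq_zero, not_le]
    exact div_pos (by linarith) (by linarith)
  -- Convergence in `L^{2*}` gives an almost everywhere convergent subsequence, along which the
  -- bound for test functions passes to the limit.
  obtain ⟨ns, hns, hae⟩ := (tendstoInMeasure_of_tendsto_eLpNorm hp
    (fun n => (hφ n).1.continuous.aestronglyMeasurable) hu.1 hφu).exists_seq_tendsto_ae
  have h0 : ∀ᵐ y : EuclideanSpace ℝ (Fin N), y ≠ 0 := by simp [ae_iff]
  filter_upwards [hae, h0] with x hx hx0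
  have hgrad : ∀ n, AEStronglyMeasurable (gradient (φ n)) volume := fun n =>
    ((InnerProductSpace.toDual ℝ _).symm.continuous.comp
      ((hφ n).1.continuous_fderiv (by simp))).aestronglyMeasurable
  have hle : ∀ n, ‖φ (ns n) x‖ₑ ≤ ENNReal.ofReal (C * ‖x‖ ^ (-((N - 2) / 2) : ℝ)) *
      (eLpNorm (fun x => gradient (φ (ns n)) x - weakGradient u x) 2 volume +
        eLpNorm (weakGradient u) 2 volume) := fun n => by
    refine (hCφ _ (hφ _) x hx0).trans ?_
    gcongr
    refine le_trans (le_of_eq ?_)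
      (eLpNorm_add_le ((hgrad (ns n)).sub hG.1) hG.1 (by norm_num))
    congr 1
    ext1 y
    simp
  have hlim : Tendsto (fun n => ENNReal.ofReal (C * ‖x‖ ^ (-((N - 2) / 2) : ℝ)) *
      (eLpNorm (fun x => gradient (φ (ns n)) x - weakGradient u x) 2 volume +
        eLpNorm (weakGradient u) 2 volume)) atTop
      (𝓝 (ENNReal.ofReal (C * ‖x‖ ^ (-((N - 2) / 2) : ℝ)) *
        (0 + eLpNorm (weakGradient u) 2 volume))) :=
    ENNReal.Tendsto.const_mul ((hφG.comp hns.tendsto_atTop).add tendsto_const_nhds)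
      (Or.inr ENNReal.ofReal_ne_top)
  rw [zero_add] at hlim
  exact le_of_tendsto_of_tendsto' hx.enorm hlim hle

/-! ### The Orlicz norm -/

/-- The modular with density `V min(u², |u|)` is bounded on the unit ball of the Orlicz norm. -/
theorem lintegral_min_le_of_orliczNorm_le_one {N : ℕ} {V : ℝ → ℝ} (hV : ∀ r, 0 < r → 0 ≤ V r)
    (hN : 0 < N) {u : EuclideanSpace ℝ (Fin N) → ℝ} (hu : orliczNorm V u ≤ 1) :
    ∫⁻ x, ENNReal.ofReal (V ‖x‖ * min (u x ^ 2) |u x|) ≤ ENNReal.ofReal 12 := by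
  have : NeZero N := ⟨hN.ne'⟩
  -- The slack from `1` to `2` yields an actual `k` without the infimum being attained. Since `1/k`
  -- is itself below `2`, this `k` exceeds `1/2`. The final `12` is `6 * 2`.
  have hlt : orliczNorm V u < ENNReal.ofReal 2 := hu.trans_lt (by simp)
  simp only [orliczNorm, iInf_lt_iff] at hlt
  obtain ⟨k, hk, hlt⟩ := hlt
  have hk2 : 1 / 2 ≤ k := by
    have h1 : ENNReal.ofReal (1 / k) < ENNReal.ofReal 2 := by
      refine lt_of_le_of_lt ?_ hlt
      rw [mul_add, mul_one]
      exact le_self_add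
    have h2 := (ENNReal.ofReal_lt_ofReal_iff (by norm_num)).1 h1
    rw [div_lt_iff₀ hk] at h2
    linarith
  have h0 : ∀ᵐ y : EuclideanSpace ℝ (Fin N), y ≠ 0 := by simp [ae_iff]
  calc ∫⁻ x, ENNReal.ofReal (V ‖x‖ * min (u x ^ 2) |u x|)
      ≤ ∫⁻ x, ENNReal.ofReal (6 * (1 / k)) * ENNReal.ofReal (V ‖x‖ * f (k * u x) ^ 2) := by
        refine lintegral_mono_ae ?_
        filter_upwards [h0] with x hx
        rw [← ENNReal.ofReal_mul (by positivity)]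
        refine ENNReal.ofReal_le_ofReal ?_
        have := mul_le_mul_of_nonneg_left (min_sq_abs_le_mul (t := u x) hk2)
          (hV _ (norm_pos_iff.2 hx))
        linarith
    _ = ENNReal.ofReal 6 * (ENNReal.ofReal (1 / k) * modular V fun x => k * u x) := by
        rw [lintegral_const_mul' _ _ ENNReal.ofReal_ne_top, ENNReal.ofReal_mul (by norm_num),
          mul_assoc, modular]
    _ ≤ ENNReal.ofReal 6 * ENNReal.ofReal 2 := by
        gcongr
        refine le_trans ?_ hlt.le
        gcongr
        exact le_add_self
    _ = _ := by rw [← ENNReal.ofReal_mul (by norm_num)]; norm_num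

/-! ### The embedding estimate -/

theorem exists_le_of_iSup_div_lt_top {V K : ℝ → ℝ} {α β R₁ : ℝ}
    (hV : ∀ r, 0 < r → 0 ≤ V r)
    (hsup : (⨆ r ∈ Set.Ioo (0 : ℝ) R₁,
      ENNReal.ofReal (K r) / ENNReal.ofReal (r ^ α * V r ^ β)) < ∞) :
    ∃ Λ : ℝ, 0 < Λ ∧ ∀ r ∈ Ioo 0 R₁, K r ≤ Λ * (r ^ α * V r ^ β) := by
  set S := ⨆ r ∈ Set.Ioo (0 : ℝ) R₁, ENNReal.ofReal (K r) / ENNReal.ofReal (r ^ α * V r ^ β)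
  refine ⟨S.toReal + 1, by positivity, fun r hr => ?_⟩
  have hVr := hV r hr.1
  have hD : 0 ≤ r ^ α * V r ^ β := mul_nonneg (Real.rpow_nonneg hr.1.le _) (Real.rpow_nonneg hVr _)
  have hle : ENNReal.ofReal (K r) / ENNReal.ofReal (r ^ α * V r ^ β) ≤ S :=
    le_iSup₂ (f := fun r _ => ENNReal.ofReal (K r) / ENNReal.ofReal (r ^ α * V r ^ β)) r hr
  -- A zero denominator is covered by `S` being finite: in `ℝ≥0∞` a nonzero numerator over zero is
  -- infinite.
  have h1 : ENNReal.ofReal (K r) ≤ S * ENNReal.ofReal (r ^ α * V r ^ β) :=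
    (ENNReal.div_le_iff_le_mul
      (Or.inr hsup.ne) (Or.inl ENNReal.ofReal_ne_top)).1 hle
  rw [← ENNReal.ofReal_toReal hsup.ne, ← ENNReal.ofReal_mul ENNReal.toReal_nonneg,
    ENNReal.ofReal_le_ofReal_iff (by positivity)] at h1
  linarith

/-- For `a ≤ 1` the minimum is `a²` and `q ≥ 2β` suffices, giving the summand `1`. For `a ≥ 1` it is
`a`, and the excess power `a^(q-β)` is absorbed by the upper bound `b`. -/
theorem rpow_le_min_rpow_mul {a b β q : ℝ} (ha : 0 ≤ a) (hab : a ≤ b) (hβ : 0 ≤ β)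
    (hq : 2 * β ≤ q) : a ^ q ≤ min (a ^ 2) a ^ β * (1 + b ^ (q - β)) := by
  have hb : 0 ≤ b ^ (q - β) := Real.rpow_nonneg (ha.trans hab) _
  rcases le_total a 1 with h | h
  · have hm : min (a ^ 2) a = a ^ 2 := min_eq_left (by nlinarith)
    rw [hm, ← Real.rpow_natCast, ← Real.rpow_mul ha]
    calc a ^ q ≤ a ^ (((2 : ℕ) : ℝ) * β) :=
          Real.rpow_le_rpow_of_exponent_ge' ha h (by positivity) (by exact_mod_cast hq)
      _ ≤ _ := le_mul_of_one_le_right (Real.rpow_nonneg ha _) (by linarith)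
  · have hm : min (a ^ 2) a = a := min_eq_right (by nlinarith)
    have ha0 : 0 < a := by linarith
    rw [hm]
    calc a ^ q = a ^ β * a ^ (q - β) := by rw [← Real.rpow_add ha0]; ring_nf
      _ ≤ a ^ β * b ^ (q - β) := by
          gcongr
          linarith
      _ ≤ _ := by
          gcongr
          linarith

theorem weight_mul_rpow_le {V K : ℝ → ℝ} {α β q C Λ r s t : ℝ} (hr : 0 < r) (hV : 0 ≤ V r)
    (hΛ : 0 < Λ) (hK : K r ≤ Λ * (r ^ α * V r ^ β)) (hC : 0 < C) (hβ : 0 ≤ β) (hq : 2 * β ≤ q)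
    (ht : |t| ≤ C * r ^ (-s)) :
    K r * |t| ^ q ≤ (V r * min (t ^ 2) |t|) ^ β * (Λ * r ^ α) +
      (V r * min (t ^ 2) |t|) ^ β * (Λ * C ^ (q - β) * r ^ (α - s * (q - β))) := by
  have h1 := rpow_le_min_rpow_mul (abs_nonneg t) ht hβ hq
  rw [sq_abs, Real.mul_rpow hC.le (by positivity), ← Real.rpow_mul hr.le] at h1
  have hm : 0 ≤ min (t ^ 2) |t| := le_min (sq_nonneg _) (abs_nonneg _)
  calc K r * |t| ^ q ≤ Λ * (r ^ α * V r ^ β) *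
        (min (t ^ 2) |t| ^ β * (1 + C ^ (q - β) * r ^ (-s * (q - β)))) := by
        have := Real.rpow_nonneg hV β
        gcongr
    _ = _ := by
        rw [Real.mul_rpow hV hm, show α - s * (q - β) = α + -s * (q - β) by ring,
          Real.rpow_add hr]
        ring

/-- The value of `V` at `0` is arbitrary, but the origin is a null set. -/
theorem aemeasurable_comp_norm {N : ℕ} [NeZero N] {V : ℝ → ℝ} (hV : ContinuousOn V (Ioi 0)) :
    AEMeasurable fun x : EuclideanSpace ℝ (Fin N) => V ‖x‖ := by
  have h : ContinuousOn (fun x : EuclideanSpace ℝ (Fin N) => V ‖x‖) {0}ᶜ :=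
    hV.comp continuous_norm.continuousOn fun x hx => norm_pos_iff.2 hx
  have := h.aemeasurable (μ := volume) (measurableSet_singleton _).compl
  rwa [restrict_compl_singleton] at this

theorem exists_S0_le {N : ℕ} (hN : 3 ≤ N) {V K : ℝ → ℝ} (hVK : HypH V K)
    {α β R₁ q : ℝ} (hβ0 : 0 ≤ β) (hβ1 : β ≤ 1) (hR₁ : 0 < R₁)
    (hsup : (⨆ r ∈ Set.Ioo (0 : ℝ) R₁,
      ENNReal.ofReal (K r) / ENNReal.ofReal (r ^ α * V r ^ β)) < ∞)
    (hq : 2 * β ≤ q) (hδ : 0 < α - (N - 2) / 2 * (q - β) + N * (1 - β)) :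
    ∃ C : ℝ, 0 < C ∧ ∀ R ∈ Set.Ioo (0 : ℝ) R₁,
      S0 N V K q R ≤ ENNReal.ofReal (C * R ^ (α - (N - 2) / 2 * (q - β) + N * (1 - β))) := by
  have : NeZero N := ⟨by omega⟩
  have hN3 : (3 : ℝ) ≤ N := by exact_mod_cast hN
  have hsq : 0 ≤ ((N : ℝ) - 2) / 2 * (q - β) := mul_nonneg (by linarith) (by linarith)
  obtain ⟨Λ, hΛ, hKΛ⟩ := exists_le_of_iSup_div_lt_top hVK.V_nonneg hsup
  obtain ⟨C, hC, hCu⟩ := exists_ae_enorm_le_of_memD12r hN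
  -- The exponent `α + N (1-β)` exceeds `δ` by `(N-2)/2 (q-β) ≥ 0`, so it is positive as well.
  obtain ⟨C₁, hC₁, h1⟩ := lintegral_ball_rpow_mul_norm_rpow_le (N := N) (by omega) hβ0 hβ1
    (γ := α) (M := 12) (by linarith) (by norm_num)
  obtain ⟨C₂, hC₂, h2⟩ := lintegral_ball_rpow_mul_norm_rpow_le (N := N) (by omega) hβ0 hβ1
    (γ := α - (N - 2) / 2 * (q - β)) (M := 12) hδ (by norm_num)
  set δ := α - (N - 2) / 2 * (q - β) + N * (1 - β) with hδdef
  refine ⟨Λ * (C₁ * R₁ ^ ((N - 2) / 2 * (q - β))) + Λ * C ^ (q - β) * C₂, by positivity,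
    fun R hR => iSup₂_le fun u hu => iSup_le fun hnorm => ?_⟩
  have hgrad : eLpNorm (weakGradient u) 2 volume ≤ 1 := hnorm ▸ le_self_add
  have horl : orliczNorm V u ≤ 1 := hnorm ▸ le_add_self
  set W : EuclideanSpace ℝ (Fin N) → ℝ≥0∞ :=
    fun x => ENNReal.ofReal (V ‖x‖ * min (u x ^ 2) |u x|) with hW
  have hum : AEMeasurable u := hu.1.1.1.aemeasurable
  have hWm : AEMeasurable W :=
    ((aemeasurable_comp_norm hVK.V_cont).mul
      ((hum.pow_const 2).min (continuous_abs.measurable.comp_aemeasurable hum))).ennreal_ofReal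
  have hWM : ∫⁻ x, W x ≤ ENNReal.ofReal 12 :=
    lintegral_min_le_of_orliczNorm_le_one hVK.V_nonneg (by omega) horl
  have h0 : ∀ᵐ y : EuclideanSpace ℝ (Fin N), y ≠ 0 := by simp [ae_iff]
  have hpt : ∀ᵐ x ∂volume.restrict (Metric.ball (0 : EuclideanSpace ℝ (Fin N)) R),
      ENNReal.ofReal (K ‖x‖ * |u x| ^ q) ≤
        ENNReal.ofReal Λ * (W x ^ β * ENNReal.ofReal (‖x‖ ^ α)) +
        ENNReal.ofReal (Λ * C ^ (q - β)) *
          (W x ^ β * ENNReal.ofReal (‖x‖ ^ (α - (N - 2) / 2 * (q - β)))) := by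
    filter_upwards [ae_restrict_of_ae h0, ae_restrict_of_ae (hCu u hu.1),
      ae_restrict_mem measurableSet_ball] with x hx0 hxu hxR
    have hr : 0 < ‖x‖ := norm_pos_iff.2 hx0
    have hrR : ‖x‖ ∈ Ioo 0 R₁ := ⟨hr, (mem_ball_zero_iff.1 hxR).trans hR.2⟩
    have hux : |u x| ≤ C * ‖x‖ ^ (-((N - 2) / 2) : ℝ) := by
      have h3 : ‖u x‖ₑ ≤ ENNReal.ofReal (C * ‖x‖ ^ (-((N - 2) / 2) : ℝ)) :=
        hxu.trans (mul_le_of_le_one_right' hgrad)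
      rwa [Real.enorm_eq_ofReal_abs, ENNReal.ofReal_le_ofReal_iff (by positivity)] at h3
    have hVx := hVK.V_nonneg _ hr
    have hm : 0 ≤ V ‖x‖ * min (u x ^ 2) |u x| :=
      mul_nonneg hVx (le_min (sq_nonneg _) (abs_nonneg _))
    refine (ENNReal.ofReal_le_ofReal
      (weight_mul_rpow_le hr hVx hΛ (hKΛ _ hrR) hC hβ0 hq hux)).trans ?_
    rw [ENNReal.ofReal_add (by positivity) (by positivity), hW]
    simp only [ENNReal.ofReal_rpow_of_nonneg hm hβ0]
    rw [← ENNReal.ofReal_mul (by positivity), ← ENNReal.ofReal_mul (by positivity),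
      ← ENNReal.ofReal_mul (by positivity), ← ENNReal.ofReal_mul (by positivity)]
    refine le_of_eq ?_
    congr 2 <;> ring
  calc ∫⁻ x in Metric.ball 0 R, ENNReal.ofReal (K ‖x‖ * |u x| ^ q)
      ≤ ∫⁻ x in Metric.ball 0 R, (ENNReal.ofReal Λ * (W x ^ β * ENNReal.ofReal (‖x‖ ^ α)) +
        ENNReal.ofReal (Λ * C ^ (q - β)) *
          (W x ^ β * ENNReal.ofReal (‖x‖ ^ (α - (N - 2) / 2 * (q - β))))) :=
        lintegral_mono_ae hpt
    _ = ENNReal.ofReal Λ * (∫⁻ x in Metric.ball 0 R, W x ^ β * ENNReal.ofReal (‖x‖ ^ α)) +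
        ENNReal.ofReal (Λ * C ^ (q - β)) * ∫⁻ x in Metric.ball 0 R,
          W x ^ β * ENNReal.ofReal (‖x‖ ^ (α - (N - 2) / 2 * (q - β))) := by
        rw [lintegral_add_left', lintegral_const_mul' _ _ ENNReal.ofReal_ne_top,
          lintegral_const_mul' _ _ ENNReal.ofReal_ne_top]
        exact ((hWm.restrict.pow_const β).mul (by fun_prop)).const_mul _
    _ ≤ ENNReal.ofReal Λ * ENNReal.ofReal (C₁ * R ^ (α + N * (1 - β))) +
        ENNReal.ofReal (Λ * C ^ (q - β)) * ENNReal.ofReal (C₂ * R ^ δ) := by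
        gcongr
        · exact h1 W hWm hWM R hR.1
        · exact h2 W hWm hWM R hR.1
    _ ≤ _ := by
        have hR0 := hR.1
        rw [← ENNReal.ofReal_mul (by positivity), ← ENNReal.ofReal_mul (by positivity),
          ← ENNReal.ofReal_add (by positivity) (by positivity)]
        refine ENNReal.ofReal_le_ofReal ?_
        -- The surplus power of `R` is bounded by the same power of `R₁`, so both terms are of order
        -- `R^δ`.
        have h4 : R ^ (α + N * (1 - β)) ≤ R₁ ^ ((N - 2) / 2 * (q - β)) * R ^ δ := by
          rw [show α + N * (1 - β) = (N - 2) / 2 * (q - β) + δ by rw [hδdef]; ring,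
            Real.rpow_add hR0]
          gcongr
          exact hR.2.le
        calc Λ * (C₁ * R ^ (α + N * (1 - β))) + Λ * C ^ (q - β) * (C₂ * R ^ δ)
            ≤ Λ * (C₁ * (R₁ ^ ((N - 2) / 2 * (q - β)) * R ^ δ)) +
              Λ * C ^ (q - β) * (C₂ * R ^ δ) := by gcongr
          _ = _ := by ring

end QuasilinearSchrodinger

end

/-! ### The theorem. -/

open QuasilinearSchrodinger in
theorem theorem3p2 (N : ℕ) (hN : 3 ≤ N) (V K : ℝ → ℝ) (hVK : HypH V K)
    (α₀ β₀ : ℝ) (hβ₀ : 0 ≤ β₀) (hβ₁ : β₀ ≤ 1) (hα₀ : alphaStar N β₀ < α₀)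
    (R₁ : ℝ) (hR₁ : 0 < R₁)
    (hsup : (⨆ r ∈ Set.Ioo (0 : ℝ) R₁,
      ENNReal.ofReal (K r) / ENNReal.ofReal (r ^ α₀ * V r ^ β₀)) < ∞)
    (q₁ : ℝ) (hq₁ : max 1 (2 * β₀) < q₁) (hq₁' : q₁ < q0Star N α₀ β₀) :
    Tendsto (fun R => S0 N V K q₁ R) (𝓝[>] 0) (𝓝 0) ∧
    ∃ δ : ℝ, 0 < δ ∧ ∃ C : ℝ, 0 < C ∧ ∀ R ∈ Set.Ioo (0 : ℝ) R₁,
      S0 N V K q₁ R ≤ ENNReal.ofReal (C * R ^ δ) := by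
  have hN3 : (3 : ℝ) ≤ N := by exact_mod_cast hN
  -- This quantity equals `(N-2)/2 * (q0Star N α₀ β₀ - q₁)`.
  have hδ : 0 < α₀ - (N - 2) / 2 * (q₁ - β₀) + N * (1 - β₀) := by
    rw [q0Star, lt_div_iff₀ (by linarith)] at hq₁'
    linarith
  obtain ⟨C, hC, hS⟩ := exists_S0_le hN hVK hβ₀ hβ₁ hR₁ hsup
    ((le_max_right _ _).trans hq₁.le) hδ
  refine ⟨?_, _, hδ, C, hC, hS⟩
  set δ := α₀ - (N - 2) / 2 * (q₁ - β₀) + N * (1 - β₀)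
  have hlim : Tendsto (fun R : ℝ => ENNReal.ofReal (C * R ^ δ)) (𝓝[>] 0) (𝓝 0) := by
    have h1 : Tendsto (fun R : ℝ => ENNReal.ofReal (C * R ^ δ)) (𝓝 0)
        (𝓝 (ENNReal.ofReal (C * 0 ^ δ))) :=
      ENNReal.tendsto_ofReal
        (((Real.continuousAt_rpow_const 0 δ (Or.inr hδ.le)).tendsto).const_mul C)
    rw [Real.zero_rpow hδ.ne', mul_zero, ENNReal.ofReal_zero] at h1
    exact h1.mono_left nhdsWithin_le_nhds
  refine tendsto_of_tendsto_of_tendsto_of_le_of_le' tendsto_const_nhds hlim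
    (Eventually.of_forall fun _ => zero_le) ?_
  filter_upwards [Ioo_mem_nhdsGT hR₁] with R hR using hS R hR
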